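/- Let $a<b$ and $A$ be real numbers, and let $V:\mathbb R\to\mathbb R$ be a $C^2$ function such that $V'$ and $V''$ do not vanish simultaneously. For $\theta\in C^1([a,b])$ put $$\mathscr E[\theta]=\int_a^b\Big(\tfrac12(\theta'(s)-A)^2-V(\theta(s))\Big)\,ds .$$ Let $\mathcal C^N$ be the set of $\tau\in C^1([a,b])\setminus\{0\}$ with $\tau'(a)=\tau'(b)=0$, and $\mathcal D^N=\mathcal C^N\cap C^2([a,b])$. A function $\theta\in C^1([a,b])$ is called stationary (for free boundaries) if $\frac{d}{d\varepsilon}\mathscr E[\theta+\varepsilon\tau]\big|_{\varepsilon=0}=0$ for all $\tau\in\mathcal C^N$. For a class $X$ of nonzero perturbations, $\theta$ is called locally minimal (stable) with respect to $X$ if for every $\tau\in X$ there is $M>0$ such that $\mathscr E[\theta+\varepsilon\tau]>\mathscr E[\theta]$ for all $\varepsilon\in[-M,M]\setminus\{0\}$. Let $\theta$ be stationary and let $X$ be any one of $C^1([a,b])\setminus\{0\}$, $\mathcal C^N$, $\mathcal D^N$. (1) Suppose that $V'(\theta(a))\neq0$, that $V'(\theta(b))\neq0$, and that there is no $s\in[a,b]$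 with $\theta'(s)=0$ and $V'(\theta(s))=0$. If the number $I[\gamma]$ of points $s\in[a,b]$ with $\theta'(s)=0$, that is, the number of times at which the phase plane trajectory $\gamma(s)=(\theta(s),\theta'(s))$ meets the horizontal axis, is at least $2$, then $\theta$ is not locally minimal with respect to $X$. (2) If $A=0$ and $\theta$ is locally minimal with respect to $X$, then $\theta$ is constant on $[a,b]$, and its value is a nondegenerate maximum point $C$ of $V$, that is, $V'(C)=0$ and $V''(C)<0$. -/

import Mathlib

open Set

noncomputable section

/-- The derivative `θ'` on `[a,b]` (one-sided at the two ends) of a function `θ : [a,b] → ℝ`.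
Functions on `[a,b]` are represented by functions `ℝ → ℝ`, of which only the values on `[a,b]`
play a role. -/
def derivOn (a b : ℝ) (θ : ℝ → ℝ) (s : ℝ) : ℝ :=
  derivWithin θ (Icc a b) s

/-- The functional `𝓔[θ] = ∫_a^b ((θ' - A)² / 2 - V(θ)) ds`. -/
def energy (V : ℝ → ℝ) (A a b : ℝ) (θ : ℝ → ℝ) : ℝ :=
  ∫ s in a..b, ((derivOn a b θ s - A) ^ 2 / 2 - V (θ s))

/-- `C¹([a,b]) \ {0}`: all perturbations. -/
def pertC1 (a b : ℝ) : Set (ℝ → ℝ) :=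
  {τ | ContDiffOn ℝ 1 τ (Icc a b) ∧ ∃ s ∈ Icc a b, τ s ≠ 0}

/-- `𝒞ᴺ([a,b])`: nonzero `C¹` perturbations with `τ'(a) = τ'(b) = 0`. -/
def pertCN (a b : ℝ) : Set (ℝ → ℝ) :=
  {τ | ContDiffOn ℝ 1 τ (Icc a b) ∧ derivOn a b τ a = 0 ∧ derivOn a b τ b = 0 ∧
    ∃ s ∈ Icc a b, τ s ≠ 0}

/-- `𝒟ᴺ([a,b])`: nonzero `C²` perturbations with `τ'(a) = τ'(b) = 0`. -/
def pertDN (a b : ℝ) : Set (ℝ → ℝ) :=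
  {τ | ContDiffOn ℝ 2 τ (Icc a b) ∧ derivOn a b τ a = 0 ∧ derivOn a b τ b = 0 ∧
    ∃ s ∈ Icc a b, τ s ≠ 0}

/-- `θ ∈ C¹([a,b])` is stationary for the problem with free boundaries: the first variation
`d/dε 𝓔[θ + ε τ]` at `ε = 0` exists and vanishes for every `τ ∈ 𝒞ᴺ([a,b])`. -/
def IsStationaryFree (V : ℝ → ℝ) (A a b : ℝ) (θ : ℝ → ℝ) : Prop :=
  ContDiffOn ℝ 1 θ (Icc a b) ∧
    ∀ τ ∈ pertCN a b, HasDerivAt (fun ε : ℝ => energy V A a b (fun s => θ s + ε * τ s)) 0 0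

/-- `θ` is locally minimal for `𝓔` with respect to the class `X` of perturbations: for every
`τ ∈ X` there is `M > 0` with `𝓔[θ + ε τ] > 𝓔[θ]` for all `ε ∈ [-M, M] \ {0}`. -/
def IsLocallyMinimal (V : ℝ → ℝ) (A a b : ℝ) (X : Set (ℝ → ℝ)) (θ : ℝ → ℝ) : Prop :=
  ∀ τ ∈ X, ∃ M : ℝ, 0 < M ∧ ∀ ε ∈ Icc (-M) M \ {0},
    energy V A a b (fun s => θ s + ε * τ s) > energy V A a b θ

/-- The phase plane trajectory `γ(s) = (θ(s), θ'(s))`. -/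
def trajectory (a b : ℝ) (θ : ℝ → ℝ) (s : ℝ) : ℝ × ℝ :=
  (θ s, derivOn a b θ s)

/-- The horizontal axis `Γ_h` of the phase plane. -/
def horizontalAxis : Set (ℝ × ℝ) :=
  {p | p.2 = 0}

/-- The index `I[γ]`: the number (possibly infinite) of `s ∈ [a,b]` with `γ(s) ∈ Γ_h`. -/
def indexI (a b : ℝ) (γ : ℝ → ℝ × ℝ) : ℕ∞ :=
  {s ∈ Icc a b | γ s ∈ horizontalAxis}.encard

end

open Filter Topology MeasureTheory

/-! Stationarity gives `θ'' = -V'(θ)` in integrated form together with `θ'(a) = θ'(b) = A`.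
Differentiating once more, the velocity `U = θ'` solves the Jacobi equation `U'' = -V''(θ) U`. If
`U` vanishes at `s₁ < s₂`, then `U` cut off outside `(s₁, s₂)` is a null direction of the second
variation, with a corner at `s₁` when `V'(θ(s₁)) ≠ 0`. Adding `ε φ`, where `φ` steps from `1` before
`s₁` to `0` after `s₂`, contributes `2 ε V'(θ(s₁)) + O(ε²)`, negative for a suitable small `ε`. Free
ends allow `φ(a) = 1`. Smoothing `U'` by cutoffs moves the direction into `𝒟ᴺ`
(`exists_secondVariation_neg`).

So at a minimum every velocity zero followed by another one is an equilibrium, which gives (1). For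
`A = 0` the velocity vanishes at both ends, so `θ` starts at an equilibrium and is constant
(`eq_of_equilibrium`); constant perturbations then give `V'' ≤ 0` there. -/

/-! ### Calculus preliminaries -/

/-- Differentiation under the integral sign over a compact interval, for a jointly continuous
derivative. -/
theorem hasDerivAt_intervalIntegral_of_continuous {F F' : ℝ → ℝ → ℝ} (a b x₀ : ℝ)
    (hF : ∀ x, Continuous (F x)) (hF' : Continuous (Function.uncurry F'))
    (h : ∀ x s, HasDerivAt (fun y => F y s) (F' x s) x) :
    HasDerivAt (fun x => ∫ s in a..b, F x s) (∫ s in a..b, F' x₀ s) x₀ := by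
  obtain ⟨K, hK⟩ := ((isCompact_closedBall x₀ 1).prod
    (isCompact_uIcc (a := a) (b := b))).exists_bound_of_continuousOn hF'.continuousOn
  refine (intervalIntegral.hasDerivAt_integral_of_dominated_loc_of_deriv_le (F := F) (F' := F')
    (bound := fun _ => K) (Metric.closedBall_mem_nhds x₀ one_pos) ?_ ?_ ?_ ?_ ?_ ?_).2
  · exact Eventually.of_forall fun x => (hF x).aestronglyMeasurable
  · exact (hF x₀).intervalIntegrable _ _
  · exact (hF'.comp (by fun_prop : Continuous fun s => (x₀, s))).aestronglyMeasurable
  · exact Eventually.of_forall fun t ht x hx => hK (x, t) ⟨hx, uIoc_subset_uIcc ht⟩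
  · exact intervalIntegrable_const
  · exact Eventually.of_forall fun t _ x _ => h x t

theorem hasDerivAt_integral_right {f : ℝ → ℝ} (hf : Continuous f) (a s : ℝ) :
    HasDerivAt (fun x => ∫ y in a..x, f y) (f s) s :=
  (hf.integral_hasStrictDerivAt a s).hasDerivAt

theorem derivOn_eq_of_eqOn {a b s : ℝ} {f g g' : ℝ → ℝ} (hab : a < b) (hfg : EqOn f g (Icc a b))
    (hg : ∀ x, HasDerivAt g (g' x) x) (hs : s ∈ Icc a b) : derivOn a b f s = g' s := by
  rw [derivOn, derivWithin_congr hfg (hfg hs)]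
  exact (hg s).hasDerivWithinAt.derivWithin (uniqueDiffOn_Icc hab s hs)

/-- A `C¹` function on `[a,b]` is the restriction of a `C¹` function on `ℝ`. -/
theorem exists_hasDerivAt_extension {a b : ℝ} (hab : a < b) {θ : ℝ → ℝ}
    (hθ : ContDiffOn ℝ 1 θ (Icc a b)) :
    ∃ Θ q : ℝ → ℝ, Continuous q ∧ (∀ s, HasDerivAt Θ (q s) s) ∧ EqOn θ Θ (Icc a b) := by
  have hc : ContinuousOn (derivWithin θ (Icc a b)) (Icc a b) :=
    hθ.continuousOn_derivWithin (uniqueDiffOn_Icc hab) le_rfl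
  -- Extending the derivative by constants beyond the ends and integrating it gives a primitive on
  -- all of `ℝ`, which removes one-sided derivatives from later arguments.
  set q : ℝ → ℝ := IccExtend hab.le ((Icc a b).domRestrict (derivWithin θ (Icc a b))) with hq
  have hqc : Continuous q := (continuousOn_iff_continuous_domRestrict.1 hc).Icc_extend'
  have hqeq : ∀ s ∈ Icc a b, q s = derivWithin θ (Icc a b) s := fun s hs => by
    rw [hq, IccExtend_of_mem _ _ hs]; rfl
  have hd : ∀ s, HasDerivAt (fun s => θ a + ∫ y in a..s, q y) (q s) s := fun s =>
    (hasDerivAt_integral_right hqc a s).const_add _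
  refine ⟨fun s => θ a + ∫ y in a..s, q y, q, hqc, hd, fun s hs => ?_⟩
  refine eq_of_derivWithin_eq (f := θ) (g := fun s => θ a + ∫ y in a..s, q y)
    (hθ.differentiableOn one_ne_zero)
    (fun x _ => (hd x).differentiableAt.differentiableWithinAt) ?_ (by simp) s hs
  intro x hx
  have hx' := Ico_subset_Icc_self hx
  rw [(hd x).hasDerivWithinAt.derivWithin (uniqueDiffOn_Icc hab x hx'), hqeq x hx']

/-! ### First and second variation, Euler-Lagrange equation -/

section Variation

variable {V : ℝ → ℝ} {A a b : ℝ} {θ Θ q τ r : ℝ → ℝ}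

theorem energy_eq_of_eqOn (V : ℝ → ℝ) (A : ℝ) (hab : a < b) (hθ : EqOn θ Θ (Icc a b))
    (hΘ : ∀ s, HasDerivAt Θ (q s) s) :
    energy V A a b θ = ∫ s in a..b, ((q s - A) ^ 2 / 2 - V (Θ s)) := by
  refine intervalIntegral.integral_congr fun s hs => ?_
  rw [uIcc_of_le hab.le] at hs
  simp only [derivOn_eq_of_eqOn hab hθ hΘ hs, hθ hs]

theorem energy_add_mul (V : ℝ → ℝ) (A : ℝ) (hab : a < b) (hθ : EqOn θ Θ (Icc a b))
    (hΘ : ∀ s, HasDerivAt Θ (q s) s) (hτ : ∀ s, HasDerivAt τ (r s) s) (ε : ℝ) :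
    energy V A a b (fun s => θ s + ε * τ s) =
      ∫ s in a..b, ((q s + ε * r s - A) ^ 2 / 2 - V (Θ s + ε * τ s)) :=
  energy_eq_of_eqOn (Θ := fun s => Θ s + ε * τ s) V A hab (fun s hs => by simp only [hθ hs])
    fun s => (hΘ s).add ((hτ s).const_mul ε)

theorem hasDerivAt_of_contDiff_two (hV : ContDiff ℝ 2 V) (x : ℝ) :
    HasDerivAt V (deriv V x) x :=
  (hV.differentiable two_ne_zero x).hasDerivAt

theorem contDiff_deriv_of_contDiff_two (hV : ContDiff ℝ 2 V) : ContDiff ℝ 1 (deriv V) :=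
  ((contDiff_succ_iff_deriv (n := 1)).1 hV).2.2

theorem hasDerivAt_deriv_of_contDiff_two (hV : ContDiff ℝ 2 V) (x : ℝ) :
    HasDerivAt (deriv V) (deriv (deriv V) x) x :=
  ((contDiff_deriv_of_contDiff_two hV).differentiable one_ne_zero x).hasDerivAt

theorem continuous_deriv_deriv_of_contDiff_two (hV : ContDiff ℝ 2 V) :
    Continuous (deriv (deriv V)) :=
  (contDiff_deriv_of_contDiff_two hV).continuous_deriv le_rfl

/-- The derivative of `ε ↦ 𝓔[θ + ε τ]`. -/
theorem hasDerivAt_energy_add_mul (hV : ContDiff ℝ 2 V) (hab : a < b) (hθ : EqOn θ Θ (Icc a b))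
    (hq : Continuous q) (hΘ : ∀ s, HasDerivAt Θ (q s) s)
    (hr : Continuous r) (hτ : ∀ s, HasDerivAt τ (r s) s) (ε : ℝ) :
    HasDerivAt (fun ε : ℝ => energy V A a b (fun s => θ s + ε * τ s))
      (∫ s in a..b, ((q s + ε * r s - A) * r s - deriv V (Θ s + ε * τ s) * τ s)) ε := by
  have hΘc : Continuous Θ := continuous_iff_continuousAt.2 fun s => (hΘ s).continuousAt
  have hτc : Continuous τ := continuous_iff_continuousAt.2 fun s => (hτ s).continuousAt
  have hV0 := hV.continuous
  have hV1 := (contDiff_deriv_of_contDiff_two hV).continuous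
  simp_rw [energy_add_mul V A hab hθ hΘ hτ]
  refine hasDerivAt_intervalIntegral_of_continuous
    (F' := fun ε s => (q s + ε * r s - A) * r s - deriv V (Θ s + ε * τ s) * τ s) a b ε
    (fun x => by fun_prop) (by simp only [Function.uncurry_def]; fun_prop) fun x s => ?_
  have h1 : HasDerivAt (fun y => q s + y * r s - A) (r s) x := by
    simpa using (((hasDerivAt_id x).mul_const (r s)).const_add (q s)).sub_const A
  have h2 : HasDerivAt (fun y => Θ s + y * τ s) (τ s) x := by
    simpa using ((hasDerivAt_id x).mul_const (τ s)).const_add (Θ s)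
  refine (((h1.pow 2).div_const 2).sub
    ((hasDerivAt_of_contDiff_two hV _).comp x h2)).congr_deriv ?_
  simp only [Nat.cast_ofNat]; ring

/-- The second derivative of `ε ↦ 𝓔[θ + ε τ]` at `0`. -/
theorem hasDerivAt_firstVariation (hV : ContDiff ℝ 2 V)
    (hq : Continuous q) (hΘ : Continuous Θ) (hr : Continuous r) (hτ : Continuous τ) :
    HasDerivAt
      (fun ε : ℝ => ∫ s in a..b, ((q s + ε * r s - A) * r s - deriv V (Θ s + ε * τ s) * τ s))
      (∫ s in a..b, (r s ^ 2 - deriv (deriv V) (Θ s) * τ s ^ 2)) 0 := by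
  have hV1 := (contDiff_deriv_of_contDiff_two hV).continuous
  have hV2 := continuous_deriv_deriv_of_contDiff_two hV
  have := hasDerivAt_intervalIntegral_of_continuous
    (F := fun ε s => (q s + ε * r s - A) * r s - deriv V (Θ s + ε * τ s) * τ s)
    (F' := fun ε s => r s ^ 2 - deriv (deriv V) (Θ s + ε * τ s) * τ s ^ 2) a b 0
    (fun x => by fun_prop) (by simp only [Function.uncurry_def]; fun_prop) fun x s => ?_
  · simpa using this
  have h1 : HasDerivAt (fun y => q s + y * r s - A) (r s) x := by
    simpa using (((hasDerivAt_id x).mul_const (r s)).const_add (q s)).sub_const A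
  have h2 : HasDerivAt (fun y => Θ s + y * τ s) (τ s) x := by
    simpa using ((hasDerivAt_id x).mul_const (τ s)).const_add (Θ s)
  refine ((h1.mul_const (r s)).sub
    (((hasDerivAt_deriv_of_contDiff_two hV _).comp x h2).mul_const (τ s))).congr_deriv ?_
  ring

theorem mem_pertDN_of_contDiff (hab : a < b) (hτ : ContDiff ℝ 2 τ)
    (hd : ∀ s, HasDerivAt τ (r s) s) (ha : r a = 0) (hb : r b = 0)
    (h0 : ∃ s ∈ Icc a b, τ s ≠ 0) : τ ∈ pertDN a b :=
  ⟨hτ.contDiffOn, by rw [derivOn_eq_of_eqOn hab (fun _ _ => rfl) hd (left_mem_Icc.2 hab.le), ha],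
    by rw [derivOn_eq_of_eqOn hab (fun _ _ => rfl) hd (right_mem_Icc.2 hab.le), hb], h0⟩

theorem contDiff_one_of_hasDerivAt (hr : Continuous r) (hτ : ∀ s, HasDerivAt τ (r s) s) :
    ContDiff ℝ 1 τ :=
  contDiff_one_iff_deriv.2 ⟨fun s => (hτ s).differentiableAt, by
    rwa [show deriv τ = r from funext fun s => (hτ s).deriv]⟩

theorem contDiff_two_of_hasDerivAt (hr : ContDiff ℝ 1 r) (hτ : ∀ s, HasDerivAt τ (r s) s) :
    ContDiff ℝ 2 τ :=
  (contDiff_succ_iff_deriv (n := 1)).2 ⟨fun s => (hτ s).differentiableAt, by simp, by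
    rwa [show deriv τ = r from funext fun s => (hτ s).deriv]⟩

theorem mem_pertCN_of_hasDerivAt (hab : a < b) (hr : Continuous r)
    (hd : ∀ s, HasDerivAt τ (r s) s) (ha : r a = 0) (hb : r b = 0)
    (h0 : ∃ s ∈ Icc a b, τ s ≠ 0) : τ ∈ pertCN a b :=
  ⟨(contDiff_one_of_hasDerivAt hr hd).contDiffOn,
    by rw [derivOn_eq_of_eqOn hab (fun _ _ => rfl) hd (left_mem_Icc.2 hab.le), ha],
    by rw [derivOn_eq_of_eqOn hab (fun _ _ => rfl) hd (right_mem_Icc.2 hab.le), hb], h0⟩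

theorem pertDN_subset_pertCN : pertDN a b ⊆ pertCN a b := fun _ h =>
  ⟨h.1.of_le one_le_two, h.2⟩

theorem pertCN_subset_pertC1 : pertCN a b ⊆ pertC1 a b := fun _ h => ⟨h.1, h.2.2.2⟩

theorem IsStationaryFree.firstVariation_eq_zero (hV : ContDiff ℝ 2 V) (hab : a < b)
    (hst : IsStationaryFree V A a b θ) (hθ : EqOn θ Θ (Icc a b))
    (hq : Continuous q) (hΘ : ∀ s, HasDerivAt Θ (q s) s) (hr : Continuous r)
    (hτ : ∀ s, HasDerivAt τ (r s) s) (ha : r a = 0) (hb : r b = 0)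
    (h0 : ∃ s ∈ Icc a b, τ s ≠ 0) :
    ∫ s in a..b, ((q s - A) * r s - deriv V (Θ s) * τ s) = 0 := by
  have h1 := hst.2 τ (mem_pertCN_of_hasDerivAt hab hr hτ ha hb h0)
  simpa using (hasDerivAt_energy_add_mul (A := A) hV hab hθ hq hΘ hr hτ 0).unique h1

/-- The integrated Euler-Lagrange equation with the natural boundary conditions. -/
theorem IsStationaryFree.eulerLagrange (hV : ContDiff ℝ 2 V) (hab : a < b)
    (hst : IsStationaryFree V A a b θ) (hθ : EqOn θ Θ (Icc a b))
    (hq : Continuous q) (hΘ : ∀ s, HasDerivAt Θ (q s) s) :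
    (∀ s ∈ Icc a b, q s = A - ∫ y in a..s, deriv V (Θ y)) ∧ ∫ y in a..b, deriv V (Θ y) = 0 := by
  have hΘc : Continuous Θ := continuous_iff_continuousAt.2 fun s => (hΘ s).continuousAt
  have hg : Continuous fun s => deriv V (Θ s) :=
    (contDiff_deriv_of_contDiff_two hV).continuous.comp hΘc
  set w : ℝ → ℝ := fun s => ∫ y in a..s, deriv V (Θ y) with hw
  have hwd : ∀ s, HasDerivAt w (deriv V (Θ s)) s := fun s => hasDerivAt_integral_right hg a s
  have hwc : Continuous w := continuous_iff_continuousAt.2 fun s => (hwd s).continuousAt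
  -- Constant perturbations are admissible; they give the boundary condition at `b`.
  have hwb : w b = 0 := by
    have := hst.firstVariation_eq_zero (τ := fun _ => 1) (r := fun _ => 0) hV hab hθ hq hΘ
      continuous_const (fun s => hasDerivAt_const s _) rfl rfl
      ⟨a, left_mem_Icc.2 hab.le, one_ne_zero⟩
    simpa [hw] using this
  refine ⟨?_, hwb⟩
  set m : ℝ → ℝ := fun s => q s - A + w s with hm
  have hmc : Continuous m := by fun_prop
  -- Du Bois-Reymond argument: the weight `(s - a) * (b - s)` makes the test velocity vanish at both
  -- ends. The constant `1` in its primitive only ensures that the perturbation is nonzero.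
  set r : ℝ → ℝ := fun s => m s * ((s - a) * (b - s)) with hr
  have hrc : Continuous r := by fun_prop
  have hτ : ∀ s, HasDerivAt (fun s => 1 + ∫ y in a..s, r y) (r s) s := fun s =>
    (hasDerivAt_integral_right hrc a s).const_add _
  have hfv := hst.firstVariation_eq_zero hV hab hθ hq hΘ hrc hτ (by simp [hr]) (by simp [hr])
      ⟨a, left_mem_Icc.2 hab.le, by simp⟩
  set τ : ℝ → ℝ := fun s => 1 + ∫ y in a..s, r y
  have hτc : Continuous τ := continuous_iff_continuousAt.2 fun s => (hτ s).continuousAt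
  -- Integration by parts without boundary terms, since `w` vanishes at `a` and `b`.
  have hparts : ∫ s in a..b, (deriv V (Θ s) * τ s + w s * r s) = 0 := by
    rw [intervalIntegral.integral_eq_sub_of_hasDerivAt (f := fun s => w s * τ s)
      (fun s _ => (hwd s).mul (hτ s))
      ((by fun_prop : Continuous fun s => deriv V (Θ s) * τ s + w s * r s).intervalIntegrable a b)]
    simp [hwb]; simp [hw]
  have hint : ∫ s in a..b, m s ^ 2 * ((s - a) * (b - s)) = 0 := by
    have := (intervalIntegral.integral_add (μ := volume)
      ((by fun_prop : Continuous fun s => (q s - A) * r s - deriv V (Θ s) * τ s).intervalIntegrable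
        a b)
      ((by fun_prop : Continuous fun s => deriv V (Θ s) * τ s + w s * r s).intervalIntegrable
        a b))
    rw [hfv, hparts, add_zero] at this
    rw [← this]
    congr 1; ext s; simp only [hr, hm]; ring
  have hzero : ∀ s ∈ Icc a b, m s ^ 2 * ((s - a) * (b - s)) = 0 := by
    by_contra! hne
    obtain ⟨s, hs, hs0⟩ := hne
    have hnn : ∀ x ∈ Icc a b, 0 ≤ m x ^ 2 * ((x - a) * (b - x)) := fun x hx =>
      mul_nonneg (sq_nonneg _) (mul_nonneg (sub_nonneg.2 hx.1) (sub_nonneg.2 hx.2))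
    refine (intervalIntegral.integral_pos hab (Continuous.continuousOn (by fun_prop))
      (fun x hx => hnn x (Ioc_subset_Icc_self hx)) ⟨s, hs, ?_⟩).ne' hint
    exact lt_of_le_of_ne (hnn s hs) hs0.symm
  have hmIoo : ∀ s ∈ Ioo a b, m s = 0 := fun s hs => by
    have h1 : (s - a) * (b - s) ≠ 0 := (mul_pos (sub_pos.2 hs.1) (sub_pos.2 hs.2)).ne'
    simpa [h1] using hzero s (Ioo_subset_Icc_self hs)
  intro s hs
  have hms : m s = 0 := by
    have : EqOn m 0 (closure (Ioo a b)) :=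
      EqOn.closure (fun x hx => hmIoo x hx) hmc continuous_const
    rw [closure_Ioo hab.ne] at this
    exact this hs
  simp only [hm] at hms
  linarith

/-- The second variation is nonnegative at local minima. -/
theorem IsLocallyMinimal.secondVariation_nonneg (hV : ContDiff ℝ 2 V) (hab : a < b)
    {X : Set (ℝ → ℝ)} (hmin : IsLocallyMinimal V A a b X θ) (hX : pertDN a b ⊆ X)
    (hst : IsStationaryFree V A a b θ) (hθ : EqOn θ Θ (Icc a b))
    (hq : Continuous q) (hΘ : ∀ s, HasDerivAt Θ (q s) s)
    (hr : ContDiff ℝ 1 r) (hτ : ∀ s, HasDerivAt τ (r s) s) (ha : r a = 0) (hb : r b = 0)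
    (h0 : ∃ s ∈ Icc a b, τ s ≠ 0) :
    0 ≤ ∫ s in a..b, (r s ^ 2 - deriv (deriv V) (Θ s) * τ s ^ 2) := by
  by_contra! hneg
  have hmem := mem_pertDN_of_contDiff hab (contDiff_two_of_hasDerivAt hr hτ) hτ ha hb h0
  have hd := hasDerivAt_energy_add_mul (A := A) hV hab hθ hq hΘ hr.continuous hτ
  have hloc : IsLocalMax (fun ε : ℝ => energy V A a b (fun s => θ s + ε * τ s)) 0 := by
    refine isLocalMax_of_deriv_deriv_neg ?_ ?_ (hd 0).continuousAt
    · rw [funext fun ε => (hd ε).deriv, (hasDerivAt_firstVariation hV hq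
        (continuous_iff_continuousAt.2 fun s => (hΘ s).continuousAt) hr.continuous
        (continuous_iff_continuousAt.2 fun s => (hτ s).continuousAt)).deriv]
      exact hneg
    · exact (hst.2 τ (pertDN_subset_pertCN hmem)).deriv
  obtain ⟨M, hM, hMlt⟩ := hmin τ (hX hmem)
  obtain ⟨δ, hδ, hball⟩ := Metric.eventually_nhds_iff.1 hloc
  have hpos : 0 < min M (δ / 2) := lt_min hM (half_pos hδ)
  have h1 := hMlt (min M (δ / 2)) ⟨⟨by linarith, min_le_left _ _⟩, hpos.ne'⟩
  have h2 := @hball (min M (δ / 2)) (by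
    rw [Real.dist_eq, sub_zero, abs_of_pos hpos]
    exact (min_le_right _ _).trans_lt (half_lt_self hδ))
  simp only [zero_mul, add_zero] at h2
  exact absurd h1 (not_lt.2 h2)

end Variation

/-! ### Cutoffs and smooth steps -/

theorem intervalIntegral_indicator_Ioo {f : ℝ → ℝ} {a b s t : ℝ} (hat : a ≤ b) (has : a ≤ s)
    (hst : s ≤ t) (htb : t ≤ b) :
    ∫ x in a..b, (Ioo s t).indicator f x = ∫ x in s..t, f x := by
  rw [intervalIntegral.integral_of_le hat, setIntegral_indicator measurableSet_Ioo,
    intervalIntegral.integral_of_le hst, integral_Ioc_eq_integral_Ioo]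
  congr 2
  exact inter_eq_right.2 fun x hx => ⟨has.trans_lt hx.1, hx.2.le.trans htb⟩

/-- A smooth cutoff supported in `[s,t]`, tending to the indicator of `(s,t)` as `n → ∞`. -/
noncomputable def cutoff (s t : ℝ) (n : ℕ) (x : ℝ) : ℝ :=
  Real.smoothTransition (n * (x - s)) * Real.smoothTransition (n * (t - x))

theorem contDiff_cutoff (s t : ℝ) (n : ℕ) : ContDiff ℝ 1 (cutoff s t n) :=
  ((Real.smoothTransition.contDiff (n := 1)).comp (by fun_prop)).mul
    ((Real.smoothTransition.contDiff (n := 1)).comp (by fun_prop))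

theorem cutoff_eq_zero_of_le {s t : ℝ} {x : ℝ} (n : ℕ) (h : x ≤ s) : cutoff s t n x = 0 := by
  rw [cutoff, Real.smoothTransition.zero_of_nonpos, zero_mul]
  exact mul_nonpos_of_nonneg_of_nonpos n.cast_nonneg (sub_nonpos.2 h)

theorem cutoff_eq_zero_of_ge {s t : ℝ} {x : ℝ} (n : ℕ) (h : t ≤ x) : cutoff s t n x = 0 := by
  rw [cutoff, Real.smoothTransition.zero_of_nonpos (x := n * (t - x)), mul_zero]
  exact mul_nonpos_of_nonneg_of_nonpos n.cast_nonneg (sub_nonpos.2 h)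

theorem abs_cutoff_le_one (s t : ℝ) (n : ℕ) (x : ℝ) : |cutoff s t n x| ≤ 1 := by
  rw [cutoff, abs_of_nonneg (mul_nonneg (Real.smoothTransition.nonneg _)
    (Real.smoothTransition.nonneg _))]
  exact mul_le_one₀ (Real.smoothTransition.le_one _) (Real.smoothTransition.nonneg _)
    (Real.smoothTransition.le_one _)

/-- At each point the sequence is eventually constant. The limiting interval is open because the
cutoffs vanish at `s` and `t`. -/
theorem tendsto_mul_cutoff (s t : ℝ) (f : ℝ → ℝ) (x : ℝ) :
    Tendsto (fun n => f x * cutoff s t n x) atTop (𝓝 ((Ioo s t).indicator f x)) := by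
  refine tendsto_const_nhds.congr' ?_
  by_cases hx : x ∈ Ioo s t
  · have h1 := (tendsto_natCast_atTop_atTop (R := ℝ)).atTop_mul_const (sub_pos.2 hx.1)
    have h2 := (tendsto_natCast_atTop_atTop (R := ℝ)).atTop_mul_const (sub_pos.2 hx.2)
    filter_upwards [h1.eventually_ge_atTop 1, h2.eventually_ge_atTop 1] with n hn1 hn2
    rw [indicator_of_mem hx, cutoff, Real.smoothTransition.one_of_one_le hn1,
      Real.smoothTransition.one_of_one_le hn2, mul_one, mul_one]
  · refine Eventually.of_forall fun n => ?_
    rw [indicator_of_notMem hx]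
    beta_reduce
    by_cases h : s < x
    · rw [cutoff_eq_zero_of_ge n (not_lt.1 fun h' => hx ⟨h, h'⟩), mul_zero]
    · rw [cutoff_eq_zero_of_le n (not_lt.1 h), mul_zero]

/-- A smooth step from `1` on `(-∞,s]` to `0` on `[t,∞)`. -/
theorem exists_smooth_step {s t : ℝ} (hst : s < t) :
    ∃ φ ψ : ℝ → ℝ, ContDiff ℝ 1 ψ ∧ (∀ x, HasDerivAt φ (ψ x) x) ∧ (∀ x ≤ s, φ x = 1) ∧
      (∀ x ≥ t, φ x = 0) ∧ (∀ x ≤ s, ψ x = 0) ∧ ∀ x ≥ t, ψ x = 0 := by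
  set φ : ℝ → ℝ := fun x => 1 - Real.smoothTransition ((x - s) / (t - s)) with hφ
  have hφc : ContDiff ℝ 2 φ :=
    contDiff_const.sub ((Real.smoothTransition.contDiff (n := 2)).comp (by fun_prop))
  have hpos : 0 < t - s := sub_pos.2 hst
  have h1 : ∀ x ≤ s, φ x = 1 := fun x hx => by
    simp only [hφ]
    rw [Real.smoothTransition.zero_of_nonpos
      (div_nonpos_of_nonpos_of_nonneg (sub_nonpos.2 hx) hpos.le), sub_zero]
  have h0 : ∀ x ≥ t, φ x = 0 := fun x hx => by
    simp only [hφ]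
    rw [Real.smoothTransition.one_of_one_le ((one_le_div hpos).2 (by linarith)), sub_self]
  have hd : ∀ x, HasDerivAt φ (deriv φ x) x := hasDerivAt_of_contDiff_two hφc
  refine ⟨φ, deriv φ, contDiff_deriv_of_contDiff_two hφc, hd, h1, h0, fun x hx => ?_,
    fun x hx => ?_⟩
  · exact (uniqueDiffOn_Iic s x hx).eq_deriv _ (hd x).hasDerivWithinAt
      ((hasDerivWithinAt_const x _ (1 : ℝ)).congr (fun y hy => h1 y hy) (h1 x hx))
  · exact (uniqueDiffOn_Ici t x hx).eq_deriv _ (hd x).hasDerivWithinAt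
      ((hasDerivWithinAt_const x _ (0 : ℝ)).congr (fun y hy => h0 y hy) (h0 x hx))

/-! ### Directions of negative second variation -/

section Instability

variable {V : ℝ → ℝ} {a b s₁ s₂ : ℝ} {Θ q U φ ψ : ℝ → ℝ}

/-- The truncated velocity `∫_a^s U' χ_n` tends to the velocity `U` cut off outside `(s₁, s₂)`, if
`U` vanishes at `s₁` and `s₂`. -/
theorem tendsto_integral_mul_cutoff {u : ℝ → ℝ} (hu : Continuous u) (has : a ≤ s₁)
    (hst : s₁ < s₂) (hU : ∀ s, HasDerivAt U (u s) s) (hU₁ : U s₁ = 0) (hU₂ : U s₂ = 0)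
    {s : ℝ} (hs : a ≤ s) :
    Tendsto (fun n => ∫ y in a..s, u y * cutoff s₁ s₂ n y) atTop
      (𝓝 ((Ioo s₁ s₂).indicator U s)) := by
  -- Since `U` vanishes at `s₁` and `s₂`, its truncation has no jumps and is the primitive of the
  -- truncated derivative.
  have hlim : ∫ y in a..s, (Ioo s₁ s₂).indicator u y = (Ioo s₁ s₂).indicator U s := by
    have hFTC : ∀ x, ∫ y in s₁..x, u y = U x := fun x => by
      rw [intervalIntegral.integral_eq_sub_of_hasDerivAt (fun y _ => hU y)
        (hu.intervalIntegrable _ _), hU₁, sub_zero]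
    rcases le_or_gt s s₁ with h1 | h1
    · rw [indicator_of_notMem fun h => absurd h.1 (not_lt.2 h1)]
      refine intervalIntegral.integral_zero_ae (Eventually.of_forall fun y hy => ?_)
      rw [uIoc_of_le hs] at hy
      exact indicator_of_notMem (fun h => absurd h.1 (not_lt.2 (hy.2.trans h1))) _
    rcases lt_or_ge s s₂ with h2 | h2
    · rw [indicator_of_mem (show s ∈ Ioo s₁ s₂ from ⟨h1, h2⟩), ← hFTC s,
        ← intervalIntegral_indicator_Ioo hs has h1.le le_rfl]
      refine intervalIntegral.integral_congr_ae ?_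
      filter_upwards [compl_mem_ae_iff.2 (measure_singleton s)] with y hy hys
      rw [uIoc_of_le hs] at hys
      have hlt : y < s := lt_of_le_of_ne hys.2 hy
      by_cases hy1 : s₁ < y
      · rw [indicator_of_mem (show y ∈ Ioo s₁ s₂ from ⟨hy1, hlt.trans h2⟩),
          indicator_of_mem (show y ∈ Ioo s₁ s from ⟨hy1, hlt⟩)]
      · rw [indicator_of_notMem fun h => hy1 h.1, indicator_of_notMem fun h => hy1 h.1]
    · rw [indicator_of_notMem fun h => absurd h.2 (not_lt.2 h2),
        intervalIntegral_indicator_Ioo hs has hst.le h2, hFTC, hU₂]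
  rw [← hlim]
  refine intervalIntegral.tendsto_integral_filter_of_dominated_convergence (fun y => |u y|) ?_ ?_
    (hu.abs.intervalIntegrable _ _) ?_
  · exact Eventually.of_forall fun n =>
      (hu.mul (contDiff_cutoff s₁ s₂ n).continuous).aestronglyMeasurable
  · refine Eventually.of_forall fun n => Eventually.of_forall fun y _ => ?_
    rw [Real.norm_eq_abs, abs_mul]
    exact mul_le_of_le_one_right (abs_nonneg _) (abs_cutoff_le_one _ _ _ _)
  · exact Eventually.of_forall fun y _ => tendsto_mul_cutoff s₁ s₂ u y

/-- The limit of the second variations along the perturbations `ε φ + ∫_a^s U' χ_n`. -/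
theorem tendsto_secondVariation_cutoff {p u : ℝ → ℝ} (hab : a < b) (has : a ≤ s₁)
    (hst : s₁ < s₂) (hsb : s₂ ≤ b) (hp : Continuous p) (hu : Continuous u)
    (hψ : Continuous ψ) (hφ : Continuous φ)
    (hU : ∀ s, HasDerivAt U (u s) s) (hU₁ : U s₁ = 0) (hU₂ : U s₂ = 0) (ε : ℝ) :
    Tendsto (fun n => ∫ s in a..b, ((ε * ψ s + u s * cutoff s₁ s₂ n s) ^ 2 -
        p s * (ε * φ s + ∫ y in a..s, u y * cutoff s₁ s₂ n y) ^ 2)) atTop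
      (𝓝 (ε ^ 2 * (∫ s in a..b, (ψ s ^ 2 - p s * φ s ^ 2)) +
        ∫ s in s₁..s₂, (2 * ε * (u s * ψ s - p s * U s * φ s) + (u s ^ 2 - p s * U s ^ 2)))) := by
  have hUc : Continuous U := continuous_iff_continuousAt.2 fun s => (hU s).continuousAt
  set D : ℝ → ℝ := fun s =>
    2 * ε * (u s * ψ s - p s * U s * φ s) + (u s ^ 2 - p s * U s ^ 2) with hD
  have hDc : Continuous D := by fun_prop
  have hlim : ε ^ 2 * (∫ s in a..b, (ψ s ^ 2 - p s * φ s ^ 2)) + ∫ s in s₁..s₂, D s =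
      ∫ s in a..b, ((ε * ψ s + (Ioo s₁ s₂).indicator u s) ^ 2 -
        p s * (ε * φ s + (Ioo s₁ s₂).indicator U s) ^ 2) := by
    rw [← intervalIntegral_indicator_Ioo hab.le has hst.le hsb,
      ← intervalIntegral.integral_const_mul, ← intervalIntegral.integral_add]
    · congr 1; ext s
      by_cases hs : s ∈ Ioo s₁ s₂
      · simp only [indicator_of_mem hs, hD]; ring
      · simp only [indicator_of_notMem hs]; ring
    · exact Continuous.intervalIntegrable (by fun_prop) _ _
    · rw [intervalIntegrable_iff]
      exact ((intervalIntegrable_iff.1 (hDc.intervalIntegrable a b)).indicator measurableSet_Ioo)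
  rw [hlim]
  obtain ⟨K, hK⟩ := (isCompact_Icc (a := a) (b := b)).exists_bound_of_continuousOn hu.continuousOn
  have hK0 : 0 ≤ K := (norm_nonneg _).trans (hK a (left_mem_Icc.2 hab.le))
  have hprim : ∀ n, Continuous fun s => ∫ y in a..s, u y * cutoff s₁ s₂ n y := fun n =>
    continuous_iff_continuousAt.2 fun s => (hasDerivAt_integral_right
      (hu.mul (contDiff_cutoff s₁ s₂ n).continuous) a s).continuousAt
  have hcut : ∀ n, ∀ s ∈ Icc a b, |u s * cutoff s₁ s₂ n s| ≤ K := fun n s hs => by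
    rw [abs_mul]
    exact (mul_le_of_le_one_right (abs_nonneg _) (abs_cutoff_le_one _ _ _ _)).trans (hK s hs)
  have hint : ∀ n, ∀ s ∈ Icc a b, |∫ y in a..s, u y * cutoff s₁ s₂ n y| ≤ K * (b - a) := by
    intro n s hs
    have := intervalIntegral.norm_integral_le_of_norm_le_const (a := a) (b := s) (C := K)
      (f := fun y => u y * cutoff s₁ s₂ n y) (fun y hy => by
        rw [uIoc_of_le hs.1] at hy
        exact hcut n y ⟨hy.1.le, hy.2.trans hs.2⟩)
    rw [abs_of_nonneg (sub_nonneg.2 hs.1)] at this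
    exact this.trans (mul_le_mul_of_nonneg_left (by linarith [hs.2]) hK0)
  refine intervalIntegral.tendsto_integral_filter_of_dominated_convergence
    (fun s => (|ε * ψ s| + K) ^ 2 + |p s| * (|ε * φ s| + K * (b - a)) ^ 2) ?_ ?_
    (Continuous.intervalIntegrable (by fun_prop) _ _) ?_
  · refine Eventually.of_forall fun n => Continuous.aestronglyMeasurable ?_
    have h1 := (contDiff_cutoff s₁ s₂ n).continuous
    have h2 := hprim n
    fun_prop
  · refine Eventually.of_forall fun n => Eventually.of_forall fun s hs => ?_
    rw [uIoc_of_le hab.le] at hs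
    have hs' := Ioc_subset_Icc_self hs
    refine (norm_sub_le _ _).trans (add_le_add ?_ ?_)
    · rw [norm_pow, Real.norm_eq_abs]
      exact pow_le_pow_left₀ (abs_nonneg _)
        ((abs_add_le _ _).trans (by gcongr; exact hcut n s hs')) 2
    · rw [norm_mul, norm_pow, Real.norm_eq_abs, Real.norm_eq_abs]
      exact mul_le_mul_of_nonneg_left (pow_le_pow_left₀ (abs_nonneg _)
        ((abs_add_le _ _).trans (by gcongr; exact hint n s hs')) 2) (abs_nonneg _)
  · refine Eventually.of_forall fun s hs => ?_
    rw [uIoc_of_le hab.le] at hs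
    exact (((tendsto_mul_cutoff s₁ s₂ u s).const_add _).pow 2).sub
      (((tendsto_integral_mul_cutoff hu has hst hU hU₁ hU₂ hs.1.le).const_add _ |>.pow 2).const_mul
        _)

/-- If the velocity of a stationary point vanishes at `s₁ < s₂`, but the acceleration does not
vanish at `s₁`, then the second variation is negative in some direction. -/
theorem exists_secondVariation_neg (hV : ContDiff ℝ 2 V) (hab : a < b) (has : a ≤ s₁)
    (hst : s₁ < s₂) (hsb : s₂ ≤ b) (hq : Continuous q) (hΘ : ∀ s, HasDerivAt Θ (q s) s)
    (hU : ∀ s, HasDerivAt U (-deriv V (Θ s)) s) (hqU : ∀ s ∈ Icc a b, q s = U s)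
    (hU₁ : U s₁ = 0) (hU₂ : U s₂ = 0) (hne : deriv V (Θ s₁) ≠ 0) :
    ∃ τ r : ℝ → ℝ, ContDiff ℝ 1 r ∧ (∀ s, HasDerivAt τ (r s) s) ∧ r a = 0 ∧ r b = 0 ∧ τ a ≠ 0 ∧
      ∫ s in a..b, (r s ^ 2 - deriv (deriv V) (Θ s) * τ s ^ 2) < 0 := by
  obtain ⟨φ, ψ, hψ, hφ, hφ₁, hφ₂, hψ₁, hψ₂⟩ := exists_smooth_step hst
  have hφc : Continuous φ := continuous_iff_continuousAt.2 fun s => (hφ s).continuousAt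
  have hψc := hψ.continuous
  have hΘc : Continuous Θ := continuous_iff_continuousAt.2 fun s => (hΘ s).continuousAt
  have hUc : Continuous U := continuous_iff_continuousAt.2 fun s => (hU s).continuousAt
  have hu1 : ContDiff ℝ 1 fun s => -deriv V (Θ s) :=
    ((contDiff_deriv_of_contDiff_two hV).comp (contDiff_one_of_hasDerivAt hq hΘ)).neg
  have huc := hu1.continuous
  have hpc : Continuous fun s => deriv (deriv V) (Θ s) :=
    (continuous_deriv_deriv_of_contDiff_two hV).comp hΘc
  have hud : ∀ s ∈ Icc a b,
      HasDerivAt (fun s => -deriv V (Θ s)) (-(deriv (deriv V) (Θ s) * U s)) s := fun s hs => by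
    rw [← hqU s hs]
    exact ((hasDerivAt_deriv_of_contDiff_two hV _).comp s (hΘ s)).neg
  have hsub : uIcc s₁ s₂ ⊆ Icc a b := by
    rw [uIcc_of_le hst.le]; exact Icc_subset_Icc has hsb
  -- By the Jacobi equation the integrand is the derivative of `2 ε U' φ + U' U`. Only the first
  -- term at `s₁` survives, where `φ = 1` and `U' = -V'(Θ)`.
  have hI : ∀ ε : ℝ, ∫ s in s₁..s₂, (2 * ε * (-deriv V (Θ s) * ψ s -
      deriv (deriv V) (Θ s) * U s * φ s) +
      ((-deriv V (Θ s)) ^ 2 - deriv (deriv V) (Θ s) * U s ^ 2)) =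
      2 * ε * deriv V (Θ s₁) := fun ε => by
    rw [intervalIntegral.integral_eq_sub_of_hasDerivAt
      (f := fun s => 2 * ε * (-deriv V (Θ s) * φ s) + -deriv V (Θ s) * U s) (fun s hs => ?_)
      (Continuous.intervalIntegrable (by fun_prop) _ _)]
    · simp only [hU₁, hU₂, hφ₁ s₁ le_rfl, hφ₂ s₂ le_rfl]; ring
    · have h := hud s (hsub hs)
      refine (((h.mul (hφ s)).const_mul (2 * ε)).add (h.mul (hU s))).congr_deriv ?_
      ring
  set Q : ℝ := ∫ s in a..b, (ψ s ^ 2 - deriv (deriv V) (Θ s) * φ s ^ 2)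
  set c : ℝ := deriv V (Θ s₁)
  have hQ : 0 < |Q| + 1 := by positivity
  obtain ⟨ε, hε, hneg⟩ : ∃ ε : ℝ, ε ≠ 0 ∧ ε ^ 2 * Q + 2 * ε * c < 0 := by
    -- With this `ε` the quadratic term is at most `c² / (|Q| + 1)`, while the linear term is `-2 c²
    -- / (|Q| + 1)`.
    refine ⟨-c / (|Q| + 1), div_ne_zero (neg_ne_zero.2 hne) hQ.ne', ?_⟩
    have hc : 0 < c ^ 2 / (|Q| + 1) := div_pos (by positivity) hQ
    have h1 : (-c / (|Q| + 1)) ^ 2 * Q + 2 * (-c / (|Q| + 1)) * c =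
        c ^ 2 / (|Q| + 1) * (Q / (|Q| + 1) - 2) := by
      field_simp
      ring
    have h2 : Q / (|Q| + 1) ≤ 1 := (div_le_one hQ).2 (by linarith [le_abs_self Q])
    rw [h1]
    exact mul_neg_of_pos_of_neg hc (by linarith)
  have hT := tendsto_secondVariation_cutoff hab has hst hsb hpc huc hψc hφc hU hU₁ hU₂ ε
  rw [hI ε] at hT
  obtain ⟨n, hn⟩ := (hT.eventually_lt_const hneg).exists
  refine ⟨fun s => ε * φ s + ∫ y in a..s, -deriv V (Θ y) * cutoff s₁ s₂ n y,
    fun s => ε * ψ s + -deriv V (Θ s) * cutoff s₁ s₂ n s, ?_, fun s => ?_, ?_, ?_, ?_, hn⟩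
  · exact (contDiff_const.mul hψ).add (hu1.mul (contDiff_cutoff s₁ s₂ n))
  · exact ((hφ s).const_mul ε).add
      (hasDerivAt_integral_right (huc.mul (contDiff_cutoff s₁ s₂ n).continuous) a s)
  · simp [hψ₁ a has, cutoff_eq_zero_of_le n has]
  · simp [hψ₂ b hsb, cutoff_eq_zero_of_ge n hsb]
  · simpa [hφ₁ a has] using hε

/-- A trajectory that starts at an equilibrium is constant. -/
theorem eq_of_equilibrium (hV : ContDiff ℝ 2 V)
    (hΘ : ∀ s, HasDerivAt Θ (q s) s)
    (hU : ∀ s, HasDerivAt U (-deriv V (Θ s)) s) (hqU : ∀ s ∈ Icc a b, q s = U s)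
    (hUa : U a = 0) (hVa : deriv V (Θ a) = 0) : ∀ s ∈ Icc a b, Θ s = Θ a := by
  have hΘc : Continuous Θ := continuous_iff_continuousAt.2 fun s => (hΘ s).continuousAt
  have hpc : Continuous fun s => deriv (deriv V) (Θ s) :=
    (continuous_deriv_deriv_of_contDiff_two hV).comp hΘc
  obtain ⟨K, hK⟩ := (isCompact_Icc (a := a) (b := b)).exists_bound_of_continuousOn hpc.continuousOn
  -- The pair `(U, V'(Θ))` solves a linear system with bounded coefficients on `[a,b]`, so
  -- Grönwall's inequality propagates its vanishing from `a`.
  set f : ℝ → ℝ × ℝ := fun s => (U s, deriv V (Θ s))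
  set f' : ℝ → ℝ × ℝ := fun s => (-deriv V (Θ s), deriv (deriv V) (Θ s) * q s)
  have hf : ∀ s, HasDerivAt f (f' s) s := fun s =>
    (hU s).prodMk ((hasDerivAt_deriv_of_contDiff_two hV _).comp s (hΘ s))
  have hbound : ∀ s ∈ Ico a b, ‖f' s‖ ≤ max 1 K * ‖f s‖ + 0 := fun s hs => by
    have hs' := Ico_subset_Icc_self hs
    rw [add_zero, Prod.norm_def]
    refine max_le ?_ ?_
    · rw [norm_neg]
      calc ‖deriv V (Θ s)‖ ≤ 1 * ‖f s‖ := by rw [one_mul]; exact norm_snd_le (f s)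
        _ ≤ _ := by gcongr; exact le_max_left _ _
    · rw [norm_mul, hqU s hs']
      exact mul_le_mul ((hK s hs').trans (le_max_right _ _)) (norm_fst_le (f s)) (norm_nonneg _)
        (zero_le_one.trans (le_max_left _ _))
  have hzero := norm_le_gronwallBound_of_norm_deriv_right_le
    (continuous_iff_continuousAt.2 fun s => (hf s).continuousAt).continuousOn
    (fun s _ => (hf s).hasDerivWithinAt) (δ := 0) (by simp [f, hUa, hVa]) hbound
  refine constant_of_has_deriv_right_zero hΘc.continuousOn fun s hs => ?_
  have hs' := Ico_subset_Icc_self hs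
  have h0 := hzero s hs'
  rw [gronwallBound_ε0_δ0, norm_le_zero_iff] at h0
  have hU0 : U s = 0 := congrArg Prod.fst h0
  have := (hΘ s).hasDerivWithinAt (s := Ici s)
  rwa [hqU s hs', hU0] at this

end Instability

/-! ### Consequences for local minima -/

/-- A local minimum has no velocity zero with nonzero acceleration that is followed by another
velocity zero. -/
theorem IsLocallyMinimal.deriv_eq_zero_of_velocity_zeros {V : ℝ → ℝ} {A a b : ℝ}
    {θ Θ q U : ℝ → ℝ} {X : Set (ℝ → ℝ)} {s₁ s₂ : ℝ} (hV : ContDiff ℝ 2 V)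
    (hab : a < b) (hmin : IsLocallyMinimal V A a b X θ) (hX : pertDN a b ⊆ X)
    (hst : IsStationaryFree V A a b θ) (hθ : EqOn θ Θ (Icc a b)) (hq : Continuous q)
    (hΘ : ∀ s, HasDerivAt Θ (q s) s) (hU : ∀ s, HasDerivAt U (-deriv V (Θ s)) s)
    (hqU : ∀ s ∈ Icc a b, q s = U s) (h₁ : s₁ ∈ Icc a b) (h₂ : s₂ ∈ Icc a b) (hlt : s₁ < s₂)
    (hU₁ : U s₁ = 0) (hU₂ : U s₂ = 0) : deriv V (Θ s₁) = 0 := by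
  by_contra hne
  obtain ⟨τ, r, hr, hτ, ha, hb, h0, hneg⟩ :=
    exists_secondVariation_neg hV hab h₁.1 hlt h₂.2 hq hΘ hU hqU hU₁ hU₂ hne
  exact absurd (hmin.secondVariation_nonneg hV hab hX hst hθ hq hΘ hr hτ ha hb
    ⟨a, left_mem_Icc.2 hab.le, h0⟩) (not_le.2 hneg)

theorem corollary1 (V : ℝ → ℝ) (hV : ContDiff ℝ 2 V)
    (hVnd : ∀ x : ℝ, ¬(deriv V x = 0 ∧ deriv (deriv V) x = 0))
    (A a b : ℝ) (hab : a < b) (θ : ℝ → ℝ) (hθ : IsStationaryFree V A a b θ)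
    (X : Set (ℝ → ℝ)) (hX : X = pertC1 a b ∨ X = pertCN a b ∨ X = pertDN a b) :
    (deriv V (θ a) ≠ 0 → deriv V (θ b) ≠ 0 →
      (¬∃ s ∈ Icc a b, derivOn a b θ s = 0 ∧ deriv V (θ s) = 0) →
      2 ≤ indexI a b (trajectory a b θ) → ¬IsLocallyMinimal V A a b X θ) ∧
    (A = 0 → IsLocallyMinimal V A a b X θ →
      ∃ C : ℝ, deriv V C = 0 ∧ deriv (deriv V) C < 0 ∧ ∀ s ∈ Icc a b, θ s = C) := by
  -- `𝒟ᴺ` is the smallest class, so destabilizing directions found there serve for all three.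
  have hDX : pertDN a b ⊆ X := by
    rcases hX with rfl | rfl | rfl
    · exact pertDN_subset_pertCN.trans pertCN_subset_pertC1
    · exact pertDN_subset_pertCN
    · exact Subset.rfl
  obtain ⟨Θ, q, hq, hΘ, hθΘ⟩ := exists_hasDerivAt_extension hab hθ.1
  obtain ⟨hEL, hELb⟩ := hθ.eulerLagrange hV hab hθΘ hq hΘ
  have ha : a ∈ Icc a b := left_mem_Icc.2 hab.le
  have hb : b ∈ Icc a b := right_mem_Icc.2 hab.le
  -- This form of the velocity is differentiable on all of `ℝ`, whereas `q` agrees with it only on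
  -- `[a,b]`.
  have hU : ∀ s, HasDerivAt (fun s => A - ∫ y in a..s, deriv V (Θ y)) (-deriv V (Θ s)) s :=
    fun s => (hasDerivAt_integral_right ((contDiff_deriv_of_contDiff_two hV).continuous.comp
      (continuous_iff_continuousAt.2 fun s => (hΘ s).continuousAt)) a s).const_sub A
  refine ⟨fun _ _ hno hindex hmin => ?_, fun hA hmin => ?_⟩
  · obtain ⟨s₁, s₂, ⟨h₁, hz₁⟩, ⟨h₂, hz₂⟩, hlt⟩ :
        ∃ s₁ s₂, (s₁ ∈ Icc a b ∧ derivOn a b θ s₁ = 0) ∧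
          (s₂ ∈ Icc a b ∧ derivOn a b θ s₂ = 0) ∧ s₁ < s₂ := by
      obtain ⟨x, y, hx, hy, hxy⟩ := one_lt_encard_iff.1
        (lt_of_lt_of_le (by norm_num : (1 : ℕ∞) < 2) hindex)
      rcases lt_or_gt_of_ne hxy with h | h
      · exact ⟨x, y, hx, hy, h⟩
      · exact ⟨y, x, hy, hx, h⟩
    have hvel : ∀ s ∈ Icc a b, derivOn a b θ s = A - ∫ y in a..s, deriv V (Θ y) := fun s hs => by
      rw [derivOn_eq_of_eqOn hab hθΘ hΘ hs, hEL s hs]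
    refine hno ⟨s₁, h₁, hz₁, ?_⟩
    rw [hθΘ h₁]
    exact hmin.deriv_eq_zero_of_velocity_zeros hV hab hDX hθ hθΘ hq hΘ hU hEL h₁ h₂ hlt
      ((hvel s₁ h₁).symm.trans hz₁) ((hvel s₂ h₂).symm.trans hz₂)
  · have hUa : A - ∫ y in a..a, deriv V (Θ y) = 0 := by simp [hA]
    have hUb : A - ∫ y in a..b, deriv V (Θ y) = 0 := by rw [hELb, hA, sub_zero]
    have hVa : deriv V (Θ a) = 0 := hmin.deriv_eq_zero_of_velocity_zeros hV hab hDX hθ hθΘ hq hΘ hU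
      hEL ha hb hab hUa hUb
    have hconst := eq_of_equilibrium hV hΘ hU hEL hUa hVa
    refine ⟨Θ a, hVa, lt_of_le_of_ne ?_ fun h => hVnd _ ⟨hVa, h⟩, fun s hs => by
      rw [hθΘ hs, hconst s hs]⟩
    -- Along `τ = 1` the second variation is `-(b - a) * V''(Θ a)`.
    have h := hmin.secondVariation_nonneg (τ := fun _ => 1) (r := fun _ => 0) hV hab hDX hθ hθΘ hq
      hΘ contDiff_const (fun s => hasDerivAt_const s _) rfl rfl ⟨a, ha, one_ne_zero⟩
    rw [intervalIntegral.integral_congr (g := fun _ => -deriv (deriv V) (Θ a)) fun s hs => by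
      rw [uIcc_of_le hab.le] at hs
      simp [hconst s hs], intervalIntegral.integral_const, smul_eq_mul] at h
    linarith [nonneg_of_mul_nonneg_right h (sub_pos.2 hab)]
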